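/- Let $G=(V,E)$ be a finite connected simple graph on $n\ge 2$ vertices. For edge weights $w:E\to[0,\infty)$ let $L(w)=D(w)-A(w)$ be the weighted Laplacian, with eigenvalues $\lambda_1(w)\le\lambda_2(w)\le\dots\le\lambda_n(w)$, and write $L=L(\mathbb 1)$, $\lambda_k=\lambda_k(\mathbb 1)$ for the uniform weights $\mathbb 1$. Call $w$ normalized if $w\ge 0$ and $\sum_{uv\in E}w_{uv}=|E|$. The graph $G$ is lower conformally rigid if $\lambda_2(w)\le\lambda_2$ for all normalized $w$, and upper conformally rigid if $\lambda_n(w)\ge\lambda_n$ for all normalized $w$. Let $\mathcal E_\lambda\subseteq\mathbb R^V$ denote the eigenspace of $L$ for $\lambda$. Let $\Psi\le\mathrm{Aut}(G)$ be a group of automorphisms that acts transitively on $V$, with orbits $\mathcal O_1,\dots,\mathcal O_s$ on the edges, and for $\varphi:V\to\mathbb R$ let $$\ell_\Psi(\varphi)=\Big(\sum_{uv\in\mathcal O_i}(\varphi(u)-\varphi(v))^2\Big)_{i=1}^s\in\mathbb R^s .$$ A 1-dimensional orbit-isometric embedding on $\mathcal E_\lambda$ is a map $p:V\to\mathbb R$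 in $\mathcal E_\lambda$ such that, for some $c>0$, $\frac1{|\mathcal O_i|}\sum_{uv\in\mathcal O_i}|p(u)-p(v)|^2=c$ for all $i$. Then: 1. For every eigenvalue $\lambda>0$ of $L$, the image $\ell_\Psi(\mathcal E_\lambda)=\{\ell_\Psi(\varphi):\varphi\in\mathcal E_\lambda\}$ is a convex cone (containing the origin). 2. $G$ is lower conformally rigid if and only if there is a single eigenvector $\varphi\in\mathcal E_{\lambda_2}$ with $\ell_\Psi(\varphi)=(|\mathcal O_1|,\dots,|\mathcal O_s|)$; equivalently, if and only if there is a 1-dimensional orbit-isometric embedding on $\mathcal E_{\lambda_2}$. 3. $G$ is upper conformally rigid if and only if there is a single eigenvector $\varphi\in\mathcal E_{\lambda_n}$ with $\ell_\Psi(\varphi)=(|\mathcal O_1|,\dots,|\mathcal O_s|)$; equivalently, if and only if there is a 1-dimensional orbit-isometric embedding on $\mathcal E_{\lambda_n}$. -/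

import Mathlib

noncomputable section

namespace SimpleGraph

variable {V : Type*} [Fintype V] [DecidableEq V] (G : SimpleGraph V) [DecidableRel G.Adj]

/-- The weighted adjacency matrix `A(w)` of edge weights `w : E → ℝ`. -/
def weightedAdjMatrix (w : G.edgeSet → ℝ) : Matrix V V ℝ :=
  Matrix.of fun u v => if h : G.Adj u v then w ⟨s(u, v), h⟩ else 0

/-- The weighted Laplacian `L(w) = D(w) - A(w)`, where `D(w)` is the diagonal matrix of
weighted degrees. -/
def weightedLapMatrix (w : G.edgeSet → ℝ) : Matrix V V ℝ :=
  Matrix.diagonal (fun u => ∑ v, G.weightedAdjMatrix w u v) - G.weightedAdjMatrix w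

theorem weightedLapMatrix_isHermitian (w : G.edgeSet → ℝ) :
    (G.weightedLapMatrix w).IsHermitian := by
  have hA : (G.weightedAdjMatrix w).IsHermitian := by
    ext u v
    by_cases h : G.Adj u v
    · simp [weightedAdjMatrix, h, h.symm, Sym2.eq_swap]
    · simp [weightedAdjMatrix, h, mt (G.adj_symm (u := v) (v := u)) h]
  exact (Matrix.isHermitian_diagonal _).sub hA

/-- For the uniform weights, the weighted Laplacian is the Laplacian `L = D - A` of `G`. -/
theorem weightedLapMatrix_one : G.weightedLapMatrix (fun _ => 1) = G.lapMatrix ℝ := by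
  have hA : G.weightedAdjMatrix (fun _ => 1) = G.adjMatrix ℝ := by
    ext u v
    simp [weightedAdjMatrix, adjMatrix_apply]
  ext u v
  simp [weightedLapMatrix, hA, lapMatrix, degMatrix, Finset.sum_boole, adjMatrix_apply,
    ← card_neighborFinset_eq_degree, neighborFinset_eq_filter]

/-- The eigenvalues of `L(w)` with multiplicity in increasing order,
`λ₁(w) ≤ λ₂(w) ≤ ⋯ ≤ λₙ(w)`, where the index `k` (counted from `0`) stands for `λₖ₊₁(w)`. -/
def lapEigenvalue (w : G.edgeSet → ℝ) (k : Fin (Fintype.card V)) : ℝ :=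
  (G.weightedLapMatrix_isHermitian w).eigenvalues₀ k.rev

theorem lapEigenvalue_monotone (w : G.edgeSet → ℝ) : Monotone (G.lapEigenvalue w) :=
  fun _ _ h => (G.weightedLapMatrix_isHermitian w).eigenvalues₀_antitone (Fin.rev_le_rev.mpr h)

/-- The second smallest eigenvalue `λ₂(w)` of `L(w)`. -/
def lambdaTwo [Nontrivial V] (w : G.edgeSet → ℝ) : ℝ :=
  G.lapEigenvalue w ⟨1, Fintype.one_lt_card⟩

/-- The largest eigenvalue `λₙ(w)` of `L(w)`. -/
def lambdaMax [Nontrivial V] (w : G.edgeSet → ℝ) : ℝ :=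
  G.lapEigenvalue w ⟨Fintype.card V - 1, Nat.sub_one_lt Fintype.card_ne_zero⟩

/-- Nonnegative edge weights with total weight `|E|`. -/
def IsNormalizedWeight (w : G.edgeSet → ℝ) : Prop :=
  (∀ e, 0 ≤ w e) ∧ ∑ e, w e = (Fintype.card G.edgeSet : ℝ)

/-- `G` is lower conformally rigid: uniform weights maximize `λ₂(w)`. -/
def IsLowerConformallyRigid [Nontrivial V] : Prop :=
  ∀ w : G.edgeSet → ℝ, G.IsNormalizedWeight w → G.lambdaTwo w ≤ G.lambdaTwo (fun _ => 1)

/-- `G` is upper conformally rigid: uniform weights minimize `λₙ(w)`. -/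
def IsUpperConformallyRigid [Nontrivial V] : Prop :=
  ∀ w : G.edgeSet → ℝ, G.IsNormalizedWeight w → G.lambdaMax (fun _ => 1) ≤ G.lambdaMax w

/-- The Laplacian `L` of `G` as an operator on `ℝ^V`. -/
abbrev lapOperator : Module.End ℝ (V → ℝ) := Matrix.toLin' (G.lapMatrix ℝ)

/-- The eigenspace `E_μ ⊆ ℝ^V` of the Laplacian. -/
abbrev lapEigenspace (μ : ℝ) : Submodule ℝ (V → ℝ) := G.lapOperator.eigenspace μ

variable {G}

/-- Two edges are equivalent if some automorphism in `Ψ` maps one to the other. -/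
def edgeOrbitSetoid (Ψ : Subgroup (G ≃g G)) : Setoid G.edgeSet where
  r e f := ∃ σ ∈ Ψ, σ.mapEdgeSet e = f
  iseqv :=
    { refl := fun e => ⟨1, Ψ.one_mem, by
        apply Subtype.ext
        change Sym2.map id e.1 = e.1
        simp⟩
      symm := by
        rintro e f ⟨σ, hσ, rfl⟩
        exact ⟨σ⁻¹, Ψ.inv_mem hσ, σ.mapEdgeSet.symm_apply_apply e⟩
      trans := by
        rintro e f g ⟨σ, hσ, rfl⟩ ⟨τ, hτ, rfl⟩
        refine ⟨τ * σ, Ψ.mul_mem hτ hσ, ?_⟩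
        apply Subtype.ext
        change Sym2.map (τ ∘ σ) e.1 = Sym2.map τ (Sym2.map σ e.1)
        rw [Sym2.map_map] }

/-- The edge orbits `O₁, …, Oₛ` of `Ψ`; vectors in `ℝˢ` are functions on this finite type. -/
def EdgeOrbit (Ψ : Subgroup (G ≃g G)) : Type _ := Quotient (edgeOrbitSetoid Ψ)

open Classical in
/-- The finite set of edges that make up an edge orbit. -/
def EdgeOrbit.edges {Ψ : Subgroup (G ≃g G)} (O : G.EdgeOrbit Ψ) : Finset G.edgeSet :=
  Finset.univ.filter fun e => Quotient.mk (edgeOrbitSetoid Ψ) e = O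

/-- The energy `(φ(u) - φ(v))²` of an edge `uv`. -/
def edgeEnergy (φ : V → ℝ) (e : G.edgeSet) : ℝ :=
  Sym2.lift ⟨fun u v => (φ u - φ v) ^ 2, fun u v => by ring⟩ e.1

/-- The orbit-energy vector `ℓ_Ψ(φ) ∈ ℝˢ`. -/
def orbitEnergy (Ψ : Subgroup (G ≃g G)) (φ : V → ℝ) : G.EdgeOrbit Ψ → ℝ :=
  fun O => ∑ e ∈ O.edges, edgeEnergy φ e

/-- The vector `(|O₁|, …, |Oₛ|)` of orbit sizes. -/
def orbitSize (Ψ : Subgroup (G ≃g G)) : G.EdgeOrbit Ψ → ℝ :=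
  fun O => (O.edges.card : ℝ)

/-- The squared length `‖p_u - p_v‖²` of an edge `uv` under a map of the vertices to `ℝʳ`. -/
def edgeSqLength {r : ℕ} (p : V → EuclideanSpace ℝ (Fin r)) (e : G.edgeSet) : ℝ :=
  Sym2.lift ⟨fun u v => ‖p u - p v‖ ^ 2, fun u v => by simp only [norm_sub_rev]⟩ e.1

variable (G) in
/-- A spectral embedding of `G` in `ℝʳ` on the eigenspace `E_μ`: the point `p_v` is the `v`-th
row of a matrix whose `r` columns lie in `E_μ`. -/
def IsSpectralEmbedding (μ : ℝ) {r : ℕ} (p : V → EuclideanSpace ℝ (Fin r)) : Prop :=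
  ∀ j : Fin r, (fun v => p v j) ∈ G.lapEigenspace μ

/-- The average squared length of the edges in an orbit is the same positive number for all
edge orbits of `Ψ`. -/
def IsOrbitIsometric (Ψ : Subgroup (G ≃g G)) {r : ℕ}
    (p : V → EuclideanSpace ℝ (Fin r)) : Prop :=
  ∃ c : ℝ, 0 < c ∧ ∀ O : G.EdgeOrbit Ψ,
    1 / (O.edges.card : ℝ) * ∑ e ∈ O.edges, edgeSqLength p e = c

/-- `G` is vertex-transitive with respect to `Ψ`. -/
def IsVertexTransitive (Ψ : Subgroup (G ≃g G)) : Prop :=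
  ∀ u v : V, ∃ σ ∈ Ψ, σ u = v

end SimpleGraph

end

set_option linter.unusedSectionVars false

noncomputable section

namespace SimpleGraph

open Matrix

/-! ### Edge energies and the weighted Laplacian form -/

section EnergyForm

variable {V : Type*} [Fintype V] [DecidableEq V] (G : SimpleGraph V) [DecidableRel G.Adj]

/-! Convexity comes from vertex-transitivity. For `φ`, `ψ` in an eigenspace, sum the rank-one
matrices of all `Ψ`-translates of `φ` and `ψ` to get a `Ψ`-invariant positive semidefinite `P` with
`L P = μ P`. Its square root `S` is again `Ψ`-invariant with columns in the eigenspace, so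
transitivity gives all columns the same orbit energies. These add up to the energies of `P`, so one
rescaled column realizes the sum (`exists_orbitEnergy_eq_of_posSemidef`, `exists_orbitEnergy_add`).

If `φ` has orbit energies `|O_i|`, the `w`-energies of its `Ψ`-translates average to the total
weight `|E| = μ‖φ‖²`, and Rayleigh bounds at the translates give rigidity. Conversely, if the vector
of sizes is not attained, Hahn–Banach separates it from the convex cone. The functional, read as
edge weights of total zero, is positive definite on the eigenspace (`exists_pos_perturbation`).
Moving the uniform weights slightly along it raises `λ₂`, and against it lowers `λₙ`. -/

/-- Summing an edge function over all ordered pairs of adjacent vertices counts each edge twice. -/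
theorem sum_sum_adj_eq_two_mul_sum_edgeSet (f : G.edgeSet → ℝ) :
    ∑ u, ∑ v, (if h : G.Adj u v then f ⟨s(u, v), h⟩ else 0) = 2 * ∑ e, f e := by
  have hdart : ∑ d : G.Dart, f ⟨d.edge, d.edge_mem⟩ =
      ∑ u, ∑ v, (if h : G.Adj u v then f ⟨s(u, v), h⟩ else 0) := by
    rw [← Fintype.sum_prod_type' (f := fun u v => if h : G.Adj u v then f ⟨s(u, v), h⟩ else 0)]
    refine Finset.sum_of_injOn (fun d => d.toProd)
      (fun d _ d' _ h => Dart.ext d d' h) (by simp) ?_ ?_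
    · rintro ⟨u, v⟩ - hp
      rw [dif_neg]
      intro h
      exact hp ⟨⟨(u, v), h⟩, by simp, rfl⟩
    · rintro ⟨⟨u, v⟩, h⟩ -
      rw [dif_pos h]
      rfl
  rw [← hdart, ← Finset.sum_fiberwise Finset.univ
    (fun d : G.Dart => (⟨d.edge, d.edge_mem⟩ : G.edgeSet)), Finset.mul_sum]
  refine Finset.sum_congr rfl fun e _ => ?_
  have hcard := G.dart_edge_fiber_card e.1 e.2
  rw [Finset.sum_congr rfl (g := fun _ => f e) (by
    intro d hd
    rw [(Finset.mem_filter.mp hd).2])]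
  rw [Finset.sum_const, nsmul_eq_mul]
  congr 1
  rw [← Nat.cast_ofNat, ← hcard]
  congr 2
  ext d
  simp [Subtype.ext_iff]

theorem weightedAdjMatrix_comm (w : G.edgeSet → ℝ) (u v : V) :
    G.weightedAdjMatrix w u v = G.weightedAdjMatrix w v u := by
  by_cases h : G.Adj u v
  · simp [weightedAdjMatrix, h, h.symm, Sym2.eq_swap]
  · simp [weightedAdjMatrix, h, mt (G.adj_symm (u := v) (v := u)) h]

theorem weightedLapMatrix_mulVec_apply (w : G.edgeSet → ℝ) (φ : V → ℝ) (u : V) :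
    (G.weightedLapMatrix w *ᵥ φ) u = ∑ v, G.weightedAdjMatrix w u v * (φ u - φ v) := by
  rw [weightedLapMatrix, sub_mulVec, Pi.sub_apply, mulVec_diagonal, Finset.sum_mul]
  simp only [mulVec, dotProduct, ← Finset.sum_sub_distrib, mul_sub]

/-- The quadratic form of the weighted Laplacian is the weighted sum of the edge energies. -/
theorem dotProduct_weightedLapMatrix_mulVec (w : G.edgeSet → ℝ) (φ : V → ℝ) :
    φ ⬝ᵥ (G.weightedLapMatrix w *ᵥ φ) = ∑ e, w e * edgeEnergy φ e := by
  have h1 : φ ⬝ᵥ (G.weightedLapMatrix w *ᵥ φ) =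
      ∑ u, ∑ v, φ u * (G.weightedAdjMatrix w u v * (φ u - φ v)) := by
    simp only [dotProduct, weightedLapMatrix_mulVec_apply, Finset.mul_sum]
  have h2 : φ ⬝ᵥ (G.weightedLapMatrix w *ᵥ φ) =
      ∑ u, ∑ v, φ v * (G.weightedAdjMatrix w u v * (φ v - φ u)) := by
    rw [h1, Finset.sum_comm]
    simp only [G.weightedAdjMatrix_comm w]
  have h3 := G.sum_sum_adj_eq_two_mul_sum_edgeSet fun e => w e * edgeEnergy φ e
  -- Adding the form to its copy with `u` and `v` exchanged completes the square on each ordered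
  -- pair.
  have h4 : φ ⬝ᵥ (G.weightedLapMatrix w *ᵥ φ) + φ ⬝ᵥ (G.weightedLapMatrix w *ᵥ φ) =
      ∑ u, ∑ v, (if h : G.Adj u v then w ⟨s(u, v), h⟩ * edgeEnergy (G := G) φ ⟨s(u, v), h⟩
        else 0) := by
    nth_rewrite 1 [h1]
    rw [h2, ← Finset.sum_add_distrib]
    refine Finset.sum_congr rfl fun u _ => ?_
    rw [← Finset.sum_add_distrib]
    refine Finset.sum_congr rfl fun v _ => ?_
    by_cases h : G.Adj u v
    · simp only [weightedAdjMatrix, of_apply, h, dif_pos, edgeEnergy, Sym2.lift_mk]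
      ring
    · simp [weightedAdjMatrix, h]
  linarith

variable {G}

theorem edgeEnergy_nonneg (φ : V → ℝ) (e : G.edgeSet) : 0 ≤ edgeEnergy φ e := by
  rcases e with ⟨⟨u, v⟩, h⟩
  exact sq_nonneg (φ u - φ v)

theorem edgeEnergy_smul (c : ℝ) (φ : V → ℝ) (e : G.edgeSet) :
    edgeEnergy (c • φ) e = c ^ 2 * edgeEnergy φ e := by
  rcases e with ⟨⟨u, v⟩, h⟩
  change (c * φ u - c * φ v) ^ 2 = c ^ 2 * (φ u - φ v) ^ 2
  ring

theorem continuous_edgeEnergy (e : G.edgeSet) :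
    Continuous fun φ : V → ℝ => edgeEnergy φ e := by
  rcases e with ⟨⟨u, v⟩, h⟩
  change Continuous fun φ : V → ℝ => (φ u - φ v) ^ 2
  fun_prop

variable (G)

theorem sum_weightedLapMatrix_mulVec (w : G.edgeSet → ℝ) (φ : V → ℝ) :
    ∑ u, (G.weightedLapMatrix w *ᵥ φ) u = 0 := by
  have h : ∑ u, (G.weightedLapMatrix w *ᵥ φ) u = - ∑ u, (G.weightedLapMatrix w *ᵥ φ) u := by
    simp only [weightedLapMatrix_mulVec_apply]
    conv_lhs => rw [Finset.sum_comm]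
    rw [← Finset.sum_neg_distrib]
    refine Finset.sum_congr rfl fun u _ => ?_
    rw [← Finset.sum_neg_distrib]
    refine Finset.sum_congr rfl fun v _ => ?_
    rw [G.weightedAdjMatrix_comm w v u]
    ring
  linarith

theorem weightedLapMatrix_mulVec_const (w : G.edgeSet → ℝ) (c : ℝ) :
    G.weightedLapMatrix w *ᵥ (fun _ => c) = 0 := by
  ext u
  simp [weightedLapMatrix_mulVec_apply]

theorem mem_lapEigenspace_iff (μ : ℝ) (φ : V → ℝ) :
    φ ∈ G.lapEigenspace μ ↔ G.lapMatrix ℝ *ᵥ φ = μ • φ := by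
  rw [Module.End.mem_eigenspace_iff, Matrix.toLin'_apply]

theorem sum_edgeEnergy_eq (φ : V → ℝ) :
    ∑ e : G.edgeSet, edgeEnergy φ e = φ ⬝ᵥ (G.lapMatrix ℝ *ᵥ φ) := by
  rw [← weightedLapMatrix_one, dotProduct_weightedLapMatrix_mulVec]
  simp

theorem sum_edgeEnergy_of_mem_lapEigenspace {μ : ℝ} {φ : V → ℝ} (hφ : φ ∈ G.lapEigenspace μ) :
    ∑ e : G.edgeSet, edgeEnergy φ e = μ * (φ ⬝ᵥ φ) := by
  rw [sum_edgeEnergy_eq, (G.mem_lapEigenspace_iff μ φ).mp hφ, dotProduct_smul, smul_eq_mul]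

theorem sum_eq_zero_of_mem_lapEigenspace {μ : ℝ} (hμ : 0 < μ) {φ : V → ℝ}
    (hφ : φ ∈ G.lapEigenspace μ) : ∑ v, φ v = 0 := by
  have h := G.sum_weightedLapMatrix_mulVec (fun _ => 1) φ
  rw [weightedLapMatrix_one, (G.mem_lapEigenspace_iff μ φ).mp hφ] at h
  simp only [Pi.smul_apply, smul_eq_mul, ← Finset.mul_sum] at h
  exact (mul_eq_zero.mp h).resolve_left hμ.ne'

end EnergyForm

/-! ### Rayleigh bounds for `λ₂(w)` and `λₙ(w)` -/

section Spectral

variable {V : Type*} [Fintype V] [DecidableEq V]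

/-- Expansion of a real symmetric matrix in an orthonormal eigenbasis, in coordinates. -/
theorem exists_eigenbasis_expansion {A : Matrix V V ℝ} (hA : A.IsHermitian) :
    ∃ b : V → V → ℝ, (∀ i j, b i ⬝ᵥ b j = if i = j then 1 else 0) ∧
      (∀ i, A *ᵥ b i = hA.eigenvalues i • b i) ∧
      (∀ x, x ⬝ᵥ x = ∑ i, (b i ⬝ᵥ x) ^ 2) ∧
      (∀ x, x ⬝ᵥ (A *ᵥ x) = ∑ i, hA.eigenvalues i * (b i ⬝ᵥ x) ^ 2) := by
  have hsum (x y : V → ℝ) : x ⬝ᵥ y =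
      ∑ i, ((hA.eigenvectorBasis i).ofLp ⬝ᵥ x) * ((hA.eigenvectorBasis i).ofLp ⬝ᵥ y) := by
    have h := hA.eigenvectorBasis.sum_inner_mul_inner (WithLp.toLp 2 x) (WithLp.toLp 2 y)
    simp only [EuclideanSpace.inner_eq_star_dotProduct, star_trivial] at h
    rw [dotProduct_comm x y, ← h]
    refine Finset.sum_congr rfl fun i _ => ?_
    rw [dotProduct_comm y]
  refine ⟨fun i => (hA.eigenvectorBasis i).ofLp, fun i j => ?_, hA.mulVec_eigenvectorBasis,
    fun x => ?_, fun x => ?_⟩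
  · have h := orthonormal_iff_ite.mp hA.eigenvectorBasis.orthonormal i j
    simp only [EuclideanSpace.inner_eq_star_dotProduct, star_trivial] at h
    rw [dotProduct_comm, h]
  · rw [hsum x x]
    simp only [sq]
  · rw [hsum x (A *ᵥ x)]
    refine Finset.sum_congr rfl fun i _ => ?_
    have hT : Aᵀ = A := conjTranspose_eq_transpose_of_trivial A ▸ hA
    rw [dotProduct_mulVec, ← mulVec_transpose, hT, hA.mulVec_eigenvectorBasis, smul_dotProduct,
      smul_eq_mul]
    ring

variable [Nontrivial V] (G : SimpleGraph V) [DecidableRel G.Adj] (w : G.edgeSet → ℝ)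

theorem exists_eigenvalues_eq_lambdaMax :
    ∃ i, (G.weightedLapMatrix_isHermitian w).eigenvalues i = G.lambdaMax w ∧
      ∀ j, (G.weightedLapMatrix_isHermitian w).eigenvalues j ≤ G.lambdaMax w := by
  set hA := G.weightedLapMatrix_isHermitian w
  set ε : Fin (Fintype.card V) ≃ V := Fintype.equivOfCardEq (Fintype.card_fin _)
  refine ⟨ε (Fin.rev ⟨Fintype.card V - 1, Nat.sub_one_lt Fintype.card_ne_zero⟩), ?_, fun j => ?_⟩
  · simp [Matrix.IsHermitian.eigenvalues, lambdaMax, lapEigenvalue, ε]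
  · apply hA.eigenvalues₀_antitone
    rw [Fin.le_def]
    simp only [Fin.val_rev]
    omega

/-- `i₀` is the slot of `λ₁(w)` and `i₁` that of `λ₂(w)`. Mathlib's `eigenvalues₀` is decreasing,
hence `Fin.rev`. -/
theorem exists_eigenvalues_eq_lambdaTwo :
    ∃ i₀ i₁, i₀ ≠ i₁ ∧
      (G.weightedLapMatrix_isHermitian w).eigenvalues i₁ = G.lambdaTwo w ∧
      (G.weightedLapMatrix_isHermitian w).eigenvalues i₀ ≤ G.lambdaTwo w ∧
      ∀ j, j ≠ i₀ → G.lambdaTwo w ≤ (G.weightedLapMatrix_isHermitian w).eigenvalues j := by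
  set hA := G.weightedLapMatrix_isHermitian w
  set ε : Fin (Fintype.card V) ≃ V := Fintype.equivOfCardEq (Fintype.card_fin _)
  have hn : 1 < Fintype.card V := Fintype.one_lt_card
  refine ⟨ε (Fin.rev ⟨0, by omega⟩), ε (Fin.rev ⟨1, hn⟩), ?_, ?_, ?_, fun j hj => ?_⟩
  · simp
  · simp [Matrix.IsHermitian.eigenvalues, lambdaTwo, lapEigenvalue, ε]
  · have : hA.eigenvalues (ε (Fin.rev ⟨0, by omega⟩)) = G.lapEigenvalue w ⟨0, by omega⟩ := by
      simp [Matrix.IsHermitian.eigenvalues, lapEigenvalue, ε]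
    rw [this]
    exact G.lapEigenvalue_monotone w (Fin.le_def.mpr (Nat.zero_le _))
  · apply hA.eigenvalues₀_antitone
    change ε.symm j ≤ _
    rw [Fin.le_def]
    have h1 : ε.symm j ≠ Fin.rev ⟨0, by omega⟩ := fun h => hj (by rw [← h, ε.apply_symm_apply])
    have h2 := (ε.symm j).isLt
    rw [Ne, Fin.ext_iff] at h1
    simp only [Fin.val_rev] at h1 ⊢
    omega

theorem dotProduct_weightedLapMatrix_mulVec_le (φ : V → ℝ) :
    φ ⬝ᵥ (G.weightedLapMatrix w *ᵥ φ) ≤ G.lambdaMax w * (φ ⬝ᵥ φ) := by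
  obtain ⟨b, -, -, hn, hq⟩ := exists_eigenbasis_expansion (G.weightedLapMatrix_isHermitian w)
  obtain ⟨i, -, hmax⟩ := G.exists_eigenvalues_eq_lambdaMax w
  rw [hq, hn, Finset.mul_sum]
  exact Finset.sum_le_sum fun j _ => mul_le_mul_of_nonneg_right (hmax j) (sq_nonneg _)

theorem exists_rayleigh_eq_lambdaMax :
    ∃ φ : V → ℝ, φ ≠ 0 ∧ φ ⬝ᵥ (G.weightedLapMatrix w *ᵥ φ) = G.lambdaMax w * (φ ⬝ᵥ φ) := by
  obtain ⟨b, ho, he, -, -⟩ := exists_eigenbasis_expansion (G.weightedLapMatrix_isHermitian w)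
  obtain ⟨i, hi, -⟩ := G.exists_eigenvalues_eq_lambdaMax w
  refine ⟨b i, fun h => ?_, ?_⟩
  · have := ho i i
    simp [h] at this
  · rw [he, hi, dotProduct_smul, smul_eq_mul]

theorem exists_rayleigh_le_lambdaTwo :
    ∃ φ : V → ℝ, φ ≠ 0 ∧ ∑ v, φ v = 0 ∧
      φ ⬝ᵥ (G.weightedLapMatrix w *ᵥ φ) ≤ G.lambdaTwo w * (φ ⬝ᵥ φ) := by
  obtain ⟨b, ho, he, -, -⟩ := exists_eigenbasis_expansion (G.weightedLapMatrix_isHermitian w)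
  obtain ⟨i₀, i₁, hne, h1, h0, -⟩ := G.exists_eigenvalues_eq_lambdaTwo w
  -- The span of the two lowest eigenvectors is a plane, so it meets the sum-zero hyperplane
  -- nontrivially.
  obtain ⟨α, β, hαβ, hsum⟩ : ∃ α β : ℝ, α ^ 2 + β ^ 2 ≠ 0 ∧
      α * ∑ v, b i₀ v + β * ∑ v, b i₁ v = 0 := by
    by_cases h : ∑ v, b i₀ v = 0
    · exact ⟨1, 0, by norm_num, by simp [h]⟩
    · exact ⟨-∑ v, b i₁ v, ∑ v, b i₀ v, by positivity, by ring⟩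
  have hnorm : (α • b i₀ + β • b i₁) ⬝ᵥ (α • b i₀ + β • b i₁) = α ^ 2 + β ^ 2 := by
    simp only [dotProduct_add, add_dotProduct, dotProduct_smul, smul_dotProduct, ho, hne,
      hne.symm, smul_eq_mul, if_true, if_false]
    ring
  refine ⟨α • b i₀ + β • b i₁, fun h => hαβ ?_, ?_, ?_⟩
  · rw [← hnorm, h, zero_dotProduct]
  · simpa [Finset.sum_add_distrib, ← Finset.mul_sum] using hsum
  · rw [hnorm]
    simp only [mulVec_add, mulVec_smul, he, h1, dotProduct_add, add_dotProduct, dotProduct_smul,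
      smul_dotProduct, ho, hne, hne.symm, smul_eq_mul, if_true, if_false]
    nlinarith [mul_le_mul_of_nonneg_right h0 (sq_nonneg α)]

variable {w}

theorem dotProduct_weightedLapMatrix_mulVec_nonneg (hw : ∀ e, 0 ≤ w e) (φ : V → ℝ) :
    0 ≤ φ ⬝ᵥ (G.weightedLapMatrix w *ᵥ φ) := by
  rw [dotProduct_weightedLapMatrix_mulVec]
  exact Finset.sum_nonneg fun e _ => mul_nonneg (hw e) (edgeEnergy_nonneg φ e)

/-- The bound holds on the complement of the lowest eigenvector `b i₀`, which is not assumed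
constant. Shifting `φ` by a constant moves it into that complement; the form is unchanged, and the
norm can only grow since `φ` is orthogonal to constants. -/
theorem lambdaTwo_mul_le (hw : ∀ e, 0 ≤ w e) {φ : V → ℝ} (hφ : ∑ v, φ v = 0) :
    G.lambdaTwo w * (φ ⬝ᵥ φ) ≤ φ ⬝ᵥ (G.weightedLapMatrix w *ᵥ φ) := by
  obtain ⟨b, ho, he, hn, hq⟩ := exists_eigenbasis_expansion (G.weightedLapMatrix_isHermitian w)
  obtain ⟨i₀, i₁, hne, h1, h0, h2⟩ := G.exists_eigenvalues_eq_lambdaTwo w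
  have hpos := G.dotProduct_weightedLapMatrix_mulVec_nonneg hw φ
  have hφn : 0 ≤ φ ⬝ᵥ φ := Finset.sum_nonneg fun v _ => mul_self_nonneg _
  rcases le_or_gt (G.lambdaTwo w) 0 with hle | hlt
  · nlinarith
  have key (x : V → ℝ) (hx : b i₀ ⬝ᵥ x = 0) :
      G.lambdaTwo w * (x ⬝ᵥ x) ≤ x ⬝ᵥ (G.weightedLapMatrix w *ᵥ x) := by
    rw [hq, hn, Finset.mul_sum]
    refine Finset.sum_le_sum fun j _ => ?_
    rcases eq_or_ne j i₀ with rfl | hj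
    · simp [hx]
    · exact mul_le_mul_of_nonneg_right (h2 j hj) (sq_nonneg _)
  set ι : V → ℝ := fun _ => 1
  have hLι : G.weightedLapMatrix w *ᵥ ι = 0 := G.weightedLapMatrix_mulVec_const w 1
  have hιι : 0 < ι ⬝ᵥ ι := by simp [ι, dotProduct, Fintype.card_pos]
  -- Otherwise `key` at the constant function would give `λ₂(w) ≤ 0`.
  have hb : b i₀ ⬝ᵥ ι ≠ 0 := by
    intro h
    have := key ι h
    rw [hLι, dotProduct_zero] at this
    nlinarith
  set a := -(b i₀ ⬝ᵥ φ) / (b i₀ ⬝ᵥ ι)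
  have hkey := key (φ + a • ι) (by
    rw [dotProduct_add, dotProduct_smul, smul_eq_mul, div_mul_cancel₀ _ hb, add_neg_cancel])
  have hιφ : ι ⬝ᵥ φ = 0 := by simpa [ι, dotProduct] using hφ
  have hιL : ι ⬝ᵥ (G.weightedLapMatrix w *ᵥ φ) = 0 := by
    simpa [ι, dotProduct] using G.sum_weightedLapMatrix_mulVec w φ
  simp only [mulVec_add, mulVec_smul, hLι, dotProduct_add, add_dotProduct, dotProduct_smul,
    smul_dotProduct, hιφ, dotProduct_comm φ ι, hιL, smul_eq_mul, smul_zero, mul_zero, add_zero,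
    zero_add] at hkey
  nlinarith [mul_nonneg hlt.le (mul_nonneg (mul_self_nonneg a) hιι.le)]

end Spectral

/-! ### Orbit energies on an eigenspace form a convex cone -/

section Convexity

open scoped MatrixOrder

variable {V : Type*} [Fintype V] [DecidableEq V] {G : SimpleGraph V} [DecidableRel G.Adj]

theorem edgeEnergy_comp (σ : G ≃g G) (φ : V → ℝ) (e : G.edgeSet) :
    edgeEnergy (φ ∘ σ) e = edgeEnergy φ (σ.mapEdgeSet e) := by
  rcases e with ⟨⟨u, v⟩, h⟩
  rfl

theorem EdgeOrbit.mem_edges {Ψ : Subgroup (G ≃g G)} {O : G.EdgeOrbit Ψ} {e : G.edgeSet} :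
    e ∈ O.edges ↔ Quotient.mk (edgeOrbitSetoid Ψ) e = O := by
  simp [EdgeOrbit.edges]

theorem EdgeOrbit.mapEdgeSet_mem_edges {Ψ : Subgroup (G ≃g G)} {O : G.EdgeOrbit Ψ}
    {σ : G ≃g G} (hσ : σ ∈ Ψ) {e : G.edgeSet} :
    σ.mapEdgeSet e ∈ O.edges ↔ e ∈ O.edges := by
  rw [mem_edges, mem_edges]
  have h : Quotient.mk (edgeOrbitSetoid Ψ) e = Quotient.mk (edgeOrbitSetoid Ψ) (σ.mapEdgeSet e) :=
    Quotient.sound ⟨σ, hσ, rfl⟩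
  rw [h]

theorem EdgeOrbit.sum_mapEdgeSet {Ψ : Subgroup (G ≃g G)} (O : G.EdgeOrbit Ψ)
    {σ : G ≃g G} (hσ : σ ∈ Ψ) (f : G.edgeSet → ℝ) :
    ∑ e ∈ O.edges, f (σ.mapEdgeSet e) = ∑ e ∈ O.edges, f e :=
  Finset.sum_equiv σ.mapEdgeSet (fun _ => (mapEdgeSet_mem_edges hσ).symm) fun _ _ => rfl

theorem orbitEnergy_comp {Ψ : Subgroup (G ≃g G)} {σ : G ≃g G} (hσ : σ ∈ Ψ) (φ : V → ℝ) :
    orbitEnergy Ψ (φ ∘ σ) = orbitEnergy Ψ φ := by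
  ext O
  simp only [orbitEnergy, edgeEnergy_comp]
  exact O.sum_mapEdgeSet hσ _

theorem orbitEnergy_smul (Ψ : Subgroup (G ≃g G)) (c : ℝ) (φ : V → ℝ) :
    orbitEnergy Ψ (c • φ) = c ^ 2 • orbitEnergy Ψ φ := by
  ext O
  simp [orbitEnergy, edgeEnergy_smul, Finset.mul_sum]

theorem comp_mem_lapEigenspace (σ : G ≃g G) {μ : ℝ} {φ : V → ℝ} (hφ : φ ∈ G.lapEigenspace μ) :
    φ ∘ σ ∈ G.lapEigenspace μ := by
  rw [mem_lapEigenspace_iff, ← weightedLapMatrix_one] at hφ ⊢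
  ext u
  have h := congrFun hφ (σ u)
  rw [weightedLapMatrix_mulVec_apply] at h ⊢
  rw [← Equiv.sum_comp σ.toEquiv] at h
  simpa [weightedAdjMatrix, show ∀ x, G.Adj (σ u) (σ x) ↔ G.Adj u x from
    fun x => σ.map_adj_iff] using h

instance finite_iso : Finite (G ≃g G) := Finite.of_injective _ DFunLike.coe_injective

/-- If the Gram matrix `P` is invariant under `Ψ`, the columns of its square root all have the same
orbit energies. -/
theorem exists_orbitEnergy_eq_of_posSemidef [Nonempty V] {Ψ : Subgroup (G ≃g G)}
    (hΨ : IsVertexTransitive Ψ) {μ : ℝ} {P : Matrix V V ℝ} (hP : P.PosSemidef)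
    (hinv : ∀ σ ∈ Ψ, P.submatrix σ σ = P) (hLP : G.lapMatrix ℝ * P = μ • P) :
    ∃ χ ∈ G.lapEigenspace μ, ∀ O : G.EdgeOrbit Ψ, orbitEnergy Ψ χ O =
      ∑ e ∈ O.edges, Sym2.lift ⟨fun u v => P u u - P u v - P v u + P v v,
        fun u v => by ring⟩ e.1 := by
  have hP0 : 0 ≤ P := nonneg_iff_posSemidef.mpr hP
  obtain ⟨S, hS, hSS⟩ : ∃ S : Matrix V V ℝ, S = CFC.sqrt P ∧ S * S = P :=
    ⟨_, rfl, CFC.sqrt_mul_sqrt_self P⟩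
  have hSpos : S.PosSemidef := nonneg_iff_posSemidef.mp (hS ▸ CFC.sqrt_nonneg P)
  have hST : Sᵀ = S := conjTranspose_eq_transpose_of_trivial S ▸ hSpos.isHermitian
  -- The relabelled `S` is a positive semidefinite square root of the relabelled `P`, which is `P`;
  -- such a root is unique.
  have hSinv : ∀ σ ∈ Ψ, S.submatrix σ σ = S := by
    intro σ hσ
    rw [hS]
    symm
    apply CFC.sqrt_unique
    · rw [← hS, show S.submatrix σ σ * S.submatrix σ σ = (S * S).submatrix σ σ from
        submatrix_mul_equiv S S σ σ.toEquiv σ, hSS, hinv σ hσ]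
    · rw [← hS]
      exact nonneg_iff_posSemidef.mpr (hSpos.submatrix σ)
  have hLS : G.lapMatrix ℝ * S = μ • S := by
    -- With `M = (L - μ)S`, `M S = (L - μ)P = 0`, hence `M Mᴴ = M S (L - μ)ᵀ = 0` and `M = 0`.
    have h : (G.lapMatrix ℝ * S - μ • S) * (G.lapMatrix ℝ * S - μ • S)ᴴ = 0 := by
      have h1 : (G.lapMatrix ℝ * S - μ • S) * S = 0 := by
        rw [sub_mul, Matrix.mul_assoc, Matrix.smul_mul, hSS, hLP, sub_self]
      have h2 : (G.lapMatrix ℝ * S - μ • S)ᴴ = S * (G.lapMatrix ℝ - μ • 1)ᵀ := by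
        rw [conjTranspose_eq_transpose_of_trivial, ← hST, ← transpose_mul, hST, sub_mul,
          Matrix.smul_mul, Matrix.one_mul]
      rw [h2, ← Matrix.mul_assoc, h1, Matrix.zero_mul]
    exact sub_eq_zero.mp (self_mul_conjTranspose_eq_zero.mp h)
  have hmem (o : V) : S.col o ∈ G.lapEigenspace μ := by
    rw [mem_lapEigenspace_iff]
    ext v
    exact congrFun (congrFun hLS v) o
  have htrans (o u : V) : orbitEnergy Ψ (S.col u) = orbitEnergy Ψ (S.col o) := by
    obtain ⟨σ, hσ, rfl⟩ := hΨ o u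
    rw [← orbitEnergy_comp hσ]
    congr 1
    ext v
    exact congrFun (congrFun (hSinv σ hσ) v) o
  obtain ⟨o⟩ := ‹Nonempty V›
  -- All `n` columns have equal orbit energies, so scaling one by `√n` gives their total.
  refine ⟨√(Fintype.card V) • S.col o, Submodule.smul_mem _ _ (hmem o), fun O => ?_⟩
  rw [orbitEnergy_smul, Real.sq_sqrt (Nat.cast_nonneg _), Pi.smul_apply, smul_eq_mul]
  have : (Fintype.card V : ℝ) * orbitEnergy Ψ (S.col o) O = ∑ u, orbitEnergy Ψ (S.col u) O := by
    rw [Finset.sum_congr rfl fun u _ => congrFun (htrans o u) O]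
    simp
  rw [this]
  simp only [orbitEnergy]
  rw [Finset.sum_comm]
  refine Finset.sum_congr rfl fun e _ => ?_
  rcases e with ⟨⟨u, v⟩, h⟩
  change ∑ o, (S u o - S v o) ^ 2 = P u u - P u v - P v u + P v v
  have hPS (a b : V) : P a b = ∑ o, S a o * S b o := by
    rw [← hSS, mul_apply]
    refine Finset.sum_congr rfl fun o _ => ?_
    nth_rewrite 2 [← hST]
    rw [transpose_apply]
  simp only [hPS, ← Finset.sum_sub_distrib, ← Finset.sum_add_distrib]
  exact Finset.sum_congr rfl fun o _ => by ring

/-- Under a vertex-transitive group, orbit energies on an eigenspace add up. -/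
theorem exists_orbitEnergy_add [Nonempty V] {Ψ : Subgroup (G ≃g G)}
    (hΨ : IsVertexTransitive Ψ) {μ : ℝ} {φ ψ : V → ℝ}
    (hφ : φ ∈ G.lapEigenspace μ) (hψ : ψ ∈ G.lapEigenspace μ) :
    ∃ χ ∈ G.lapEigenspace μ, orbitEnergy Ψ χ = orbitEnergy Ψ φ + orbitEnergy Ψ ψ := by
  have := Fintype.ofFinite Ψ
  set N : ℝ := (Fintype.card Ψ : ℝ)
  have hN : N ≠ 0 := by simp [N]
  let Q (x : V → ℝ) : Matrix V V ℝ :=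
    ∑ σ : Ψ, vecMulVec (x ∘ σ.1) (x ∘ σ.1)
  have hQ (x : V → ℝ) : (Q x).PosSemidef :=
    posSemidef_sum _ fun σ _ => by simpa using posSemidef_vecMulVec_self_star (x ∘ σ.1)
  have hQinv (x : V → ℝ) (τ) (hτ : τ ∈ Ψ) : (Q x).submatrix τ τ = Q x := by
    ext u v
    simp only [Q, submatrix_apply, Matrix.sum_apply, vecMulVec_apply]
    -- Precomposition with `τ` permutes the summands through `σ ↦ σ * τ`.
    exact Fintype.sum_equiv (Equiv.mulRight (⟨τ, hτ⟩ : Ψ)) _ _ fun σ => rfl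
  have hLQ (x : V → ℝ) (hx : x ∈ G.lapEigenspace μ) : G.lapMatrix ℝ * Q x = μ • Q x := by
    simp only [Q, Finset.mul_sum, Finset.smul_sum]
    refine Finset.sum_congr rfl fun σ _ => ?_
    rw [mul_vecMulVec, (mem_lapEigenspace_iff _ _ _).mp (comp_mem_lapEigenspace σ.1 hx),
      smul_vecMulVec]
  have hE (x : V → ℝ) (O : G.EdgeOrbit Ψ) :
      ∑ e ∈ O.edges, Sym2.lift ⟨fun u v => Q x u u - Q x u v - Q x v u + Q x v v,
        fun u v => by ring⟩ e.1 = N * orbitEnergy Ψ x O := by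
    have h1 : N * orbitEnergy Ψ x O = ∑ σ : Ψ, orbitEnergy Ψ (x ∘ σ.1) O := by
      rw [Finset.sum_congr rfl fun σ _ => congrFun (orbitEnergy_comp σ.2 x) O]
      simp [N]
    rw [h1]
    simp only [orbitEnergy]
    rw [Finset.sum_comm]
    refine Finset.sum_congr rfl fun e _ => ?_
    rcases e with ⟨⟨u, v⟩, h⟩
    change Q x u u - Q x u v - Q x v u + Q x v v = ∑ σ : Ψ, (x (σ.1 u) - x (σ.1 v)) ^ 2
    simp only [Q, Matrix.sum_apply, vecMulVec_apply, ← Finset.sum_sub_distrib,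
      ← Finset.sum_add_distrib]
    exact Finset.sum_congr rfl fun σ _ => by simp only [Function.comp_apply]; ring
  obtain ⟨χ, hχ, h⟩ := exists_orbitEnergy_eq_of_posSemidef hΨ (μ := μ) (P := Q φ + Q ψ)
    ((hQ φ).add (hQ ψ))
    (fun σ hσ => by
      rw [submatrix_add, Pi.add_apply, Pi.add_apply, hQinv φ σ hσ, hQinv ψ σ hσ])
    (by rw [Matrix.mul_add, hLQ φ hφ, hLQ ψ hψ, smul_add])
  -- `Q` sums over `Ψ` without dividing, so each energy carries a factor `N`.
  refine ⟨(√N)⁻¹ • χ, Submodule.smul_mem _ _ hχ, ?_⟩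
  ext O
  rw [orbitEnergy_smul, Pi.smul_apply, h, inv_pow, Real.sq_sqrt (Nat.cast_nonneg _), smul_eq_mul,
    inv_mul_eq_iff_eq_mul₀ hN, Pi.add_apply, mul_add, ← hE, ← hE]
  refine Eq.trans (Finset.sum_congr rfl fun e _ => ?_) Finset.sum_add_distrib
  rcases e with ⟨⟨u, v⟩, h⟩
  change (Q φ u u + Q ψ u u) - (Q φ u v + Q ψ u v) - (Q φ v u + Q ψ v u)
    + (Q φ v v + Q ψ v v) =
      (Q φ u u - Q φ u v - Q φ v u + Q φ v v) + (Q ψ u u - Q ψ u v - Q ψ v u + Q ψ v v)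
  ring

theorem smul_orbitEnergy_mem_image {Ψ : Subgroup (G ≃g G)} {μ c : ℝ} (hc : 0 ≤ c) {φ : V → ℝ}
    (hφ : φ ∈ G.lapEigenspace μ) :
    ∃ χ ∈ G.lapEigenspace μ, orbitEnergy Ψ χ = c • orbitEnergy Ψ φ :=
  ⟨√c • φ, Submodule.smul_mem _ _ hφ, by rw [orbitEnergy_smul, Real.sq_sqrt hc]⟩

/-- The orbit energies of the functions in an eigenspace form a convex cone. -/
theorem exists_pointedCone_eq_image_orbitEnergy [Nonempty V] {Ψ : Subgroup (G ≃g G)}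
    (hΨ : IsVertexTransitive Ψ) (μ : ℝ) :
    ∃ C : PointedCone ℝ (G.EdgeOrbit Ψ → ℝ),
      (C : Set (G.EdgeOrbit Ψ → ℝ)) = orbitEnergy Ψ '' (G.lapEigenspace μ : Set (V → ℝ)) := by
  refine ⟨
    { carrier := orbitEnergy Ψ '' (G.lapEigenspace μ : Set (V → ℝ))
      add_mem' := ?_
      zero_mem' := ⟨0, Submodule.zero_mem _, ?_⟩
      smul_mem' := ?_ }, rfl⟩
  · rintro _ _ ⟨φ, hφ, rfl⟩ ⟨ψ, hψ, rfl⟩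
    exact exists_orbitEnergy_add hΨ hφ hψ
  · rw [← zero_smul ℝ (0 : V → ℝ), orbitEnergy_smul]
    simp
  · rintro ⟨c, hc⟩ _ ⟨φ, hφ, rfl⟩
    exact smul_orbitEnergy_mem_image hc hφ

end Convexity

/-! ### Compactness and semidefinite forms -/

section Auxiliary

variable {V : Type*} [Fintype V] [DecidableEq V]

theorem isCompact_setOf_dotProduct_self_eq_one : IsCompact {φ : V → ℝ | φ ⬝ᵥ φ = 1} := by
  refine Metric.isCompact_of_isClosed_isBounded
    (isClosed_eq (by simp only [dotProduct]; fun_prop) continuous_const) ?_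
  refine (Metric.isBounded_closedBall (x := (0 : V → ℝ)) (r := 1)).subset fun φ hφ => ?_
  rw [mem_closedBall_zero_iff, pi_norm_le_iff_of_nonneg zero_le_one]
  intro v
  rw [Real.norm_eq_abs, ← sq_le_one_iff_abs_le_one, ← (hφ : φ ⬝ᵥ φ = 1), sq]
  exact Finset.single_le_sum (f := fun v => φ v * φ v) (fun u _ => mul_self_nonneg _)
    (Finset.mem_univ v)

theorem dotProduct_self_pos {φ : V → ℝ} (hφ : φ ≠ 0) : 0 < φ ⬝ᵥ φ := by
  refine lt_of_le_of_ne (Finset.sum_nonneg fun v _ => mul_self_nonneg _) fun h => hφ ?_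
  exact dotProduct_self_eq_zero.mp h.symm

theorem exists_smul_dotProduct_self_eq_one {φ : V → ℝ} (hφ : φ ≠ 0) :
    ∃ c : ℝ, c ≠ 0 ∧ (c • φ) ⬝ᵥ (c • φ) = 1 := by
  have hpos := dotProduct_self_pos hφ
  refine ⟨(√(φ ⬝ᵥ φ))⁻¹, by positivity, ?_⟩
  rw [smul_dotProduct, dotProduct_smul, smul_smul, smul_eq_mul, ← mul_inv,
    Real.mul_self_sqrt hpos.le, inv_mul_cancel₀ hpos.ne']

/-- A function that is nonnegative on a compact set becomes positive after adding a small positive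
multiple of a function that is positive on its zeros. -/
theorem exists_forall_pos_add_mul {X : Type*} [TopologicalSpace X] {K : Set X} (hK : IsCompact K)
    {f g : X → ℝ} (hf : Continuous f) (hg : Continuous g) (hf0 : ∀ x ∈ K, 0 ≤ f x)
    (hfg : ∀ x ∈ K, f x = 0 → 0 < g x) :
    ∃ t₀ > 0, ∀ t, 0 < t → t ≤ t₀ → ∀ x ∈ K, 0 < f x + t * g x := by
  -- Only points with `g ≤ 0` are at risk; there `f` is positive, so by compactness it is at least
  -- some `δ > 0`.
  have hA : IsCompact (K ∩ {x | g x ≤ 0}) := hK.inter_right (isClosed_le hg continuous_const)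
  obtain ⟨δ, hδ, hδf⟩ : ∃ δ > 0, ∀ x ∈ K ∩ {x | g x ≤ 0}, δ ≤ f x :=
    hA.exists_forall_le' hf.continuousOn fun x hx =>
      lt_of_le_of_ne (hf0 x hx.1) fun h => (hfg x hx.1 h.symm).not_ge hx.2
  obtain ⟨M, hM⟩ := hK.exists_bound_of_continuousOn hg.continuousOn
  refine ⟨δ / (|M| + 1), by positivity, fun t ht htle x hx => ?_⟩
  rcases le_or_gt (g x) 0 with hgx | hgx
  · have h1 := hδf x ⟨hx, hgx⟩
    have h2 : t * (|M| + 1) ≤ δ := (le_div_iff₀ (by positivity)).mp htle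
    have h3 : -g x ≤ |M| := (neg_le_abs _).trans ((hM x hx).trans (le_abs_self M))
    nlinarith [mul_le_mul_of_nonneg_left h3 ht.le]
  · have := hf0 x hx
    positivity

/-- A symmetric form that is nonnegative on an invariant subspace is degenerate at its isotropic
vectors. -/
theorem mulVec_eq_zero_of_dotProduct_mulVec_eq_zero {B : Matrix V V ℝ} (hB : Bᵀ = B)
    (W : Submodule ℝ (V → ℝ)) (hW : ∀ x ∈ W, B *ᵥ x ∈ W) (h0 : ∀ x ∈ W, 0 ≤ x ⬝ᵥ (B *ᵥ x))
    {φ : V → ℝ} (hφ : φ ∈ W) (h : φ ⬝ᵥ (B *ᵥ φ) = 0) : B *ᵥ φ = 0 := by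
  by_contra hne
  set ψ := B *ᵥ φ with hψ
  have hs := dotProduct_self_pos hne
  have hc := h0 ψ (hW φ hφ)
  have hsymm : φ ⬝ᵥ (B *ᵥ ψ) = ψ ⬝ᵥ ψ := by
    rw [dotProduct_mulVec, ← mulVec_transpose, hB]
  set s := ψ ⬝ᵥ ψ
  set c := ψ ⬝ᵥ (B *ᵥ ψ)
  -- This makes the form at `φ + t • ψ` equal to `-t²(c + 2) < 0`; the `+ 1` covers `c = 0`.
  set t := -s / (c + 1) with ht
  have h1 := h0 (φ + t • ψ) (W.add_mem hφ (W.smul_mem t (hW φ hφ)))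
  have h2 : (φ + t • ψ) ⬝ᵥ (B *ᵥ (φ + t • ψ)) = 2 * t * s + t ^ 2 * c := by
    simp only [mulVec_add, mulVec_smul, ← hψ, dotProduct_add, add_dotProduct, dotProduct_smul,
      smul_dotProduct, smul_eq_mul, h, hsymm]
    change 0 + t * s + t * (s + t * c) = _
    ring
  have hts : s = -t * (c + 1) := by
    rw [ht]
    field_simp
  have htneg : t < 0 := div_neg_of_neg_of_pos (neg_lt_zero.mpr hs) (by linarith)
  rw [h2, hts] at h1
  nlinarith [mul_pos_of_neg_of_neg htneg htneg,
    mul_nonneg (mul_pos_of_neg_of_neg htneg htneg).le hc]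

end Auxiliary

/-! ### Separation, averaging and the rigidity criteria -/

section Rigidity

variable {V : Type*} [Fintype V] [DecidableEq V] {G : SimpleGraph V} [DecidableRel G.Adj]

instance finite_edgeOrbit (Ψ : Subgroup (G ≃g G)) : Finite (G.EdgeOrbit Ψ) :=
  inferInstanceAs (Finite (Quotient (edgeOrbitSetoid Ψ)))

instance fintypeEdgeOrbit (Ψ : Subgroup (G ≃g G)) : Fintype (G.EdgeOrbit Ψ) := Fintype.ofFinite _

theorem sum_edgeOrbit (Ψ : Subgroup (G ≃g G)) (f : G.edgeSet → ℝ) :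
    ∑ O : G.EdgeOrbit Ψ, ∑ e ∈ O.edges, f e = ∑ e, f e := by
  classical
  rw [← Finset.sum_fiberwise (κ := G.EdgeOrbit Ψ) Finset.univ
    (fun e => Quotient.mk (edgeOrbitSetoid Ψ) e) f]
  refine Finset.sum_congr rfl fun O _ => Finset.sum_congr ?_ fun _ _ => rfl
  ext e
  rw [EdgeOrbit.mem_edges, Finset.mem_filter]
  exact (and_iff_right (Finset.mem_univ e)).symm

/-- Reads a linear functional on orbit vectors as edge weights constant on orbits; this turns the
separating functional into a perturbation. -/
theorem sum_mul_edgeOrbit (Ψ : Subgroup (G ≃g G)) (y : G.EdgeOrbit Ψ → ℝ) (f : G.edgeSet → ℝ) :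
    ∑ O : G.EdgeOrbit Ψ, (∑ e ∈ O.edges, f e) * y O =
      ∑ e, y (Quotient.mk (edgeOrbitSetoid Ψ) e) * f e := by
  rw [← sum_edgeOrbit Ψ]
  refine Finset.sum_congr rfl fun O _ => ?_
  rw [Finset.sum_mul]
  refine Finset.sum_congr rfl fun e he => ?_
  rw [EdgeOrbit.mem_edges.mp he, mul_comm]

theorem EdgeOrbit.card_edges_pos {Ψ : Subgroup (G ≃g G)} (O : G.EdgeOrbit Ψ) :
    0 < (O.edges.card : ℝ) := by
  obtain ⟨e, he⟩ := Quotient.exists_rep O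
  exact Nat.cast_pos.mpr (Finset.card_pos.mpr ⟨e, EdgeOrbit.mem_edges.mpr he⟩)

theorem sum_orbitSize (Ψ : Subgroup (G ≃g G)) :
    ∑ O, orbitSize Ψ O = (Fintype.card G.edgeSet : ℝ) := by
  have := sum_edgeOrbit Ψ (fun _ => 1)
  simpa [orbitSize] using this

theorem sum_orbitEnergy_of_mem_lapEigenspace (Ψ : Subgroup (G ≃g G)) {μ : ℝ} {φ : V → ℝ}
    (hφ : φ ∈ G.lapEigenspace μ) : ∑ O, orbitEnergy Ψ φ O = μ * (φ ⬝ᵥ φ) := by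
  rw [← G.sum_edgeEnergy_of_mem_lapEigenspace hφ]
  exact sum_edgeOrbit Ψ _

theorem continuous_orbitEnergy (Ψ : Subgroup (G ≃g G)) :
    Continuous (orbitEnergy Ψ : (V → ℝ) → G.EdgeOrbit Ψ → ℝ) :=
  continuous_pi fun _ => continuous_finsetSum _ fun e _ => continuous_edgeEnergy e

/-- If the orbit sizes are not an orbit-energy vector on an eigenspace, some perturbation of the
weights with total weight zero is positive definite on this eigenspace. -/
theorem exists_pos_perturbation [Nonempty V] {Ψ : Subgroup (G ≃g G)} (hΨ : IsVertexTransitive Ψ)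
    [Nonempty G.edgeSet] {μ : ℝ} (hμ : 0 < μ)
    (h : ¬ ∃ φ ∈ G.lapEigenspace μ, orbitEnergy Ψ φ = orbitSize Ψ) :
    ∃ y : G.edgeSet → ℝ, ∑ e, y e = 0 ∧
      ∀ φ ∈ G.lapEigenspace μ, φ ≠ 0 → 0 < ∑ e, y e * edgeEnergy φ e := by
  classical
  set m : ℝ := (Fintype.card G.edgeSet : ℝ)
  have hm : 0 < m := Nat.cast_pos.mpr Fintype.card_pos
  -- Energies of `φ` total `μ‖φ‖²`, so unit vectors cut the cone in the hyperplane of coordinate sum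
  -- `μ`, giving a compact convex base.
  set U : Set (V → ℝ) := {φ | φ ⬝ᵥ φ = 1} ∩ G.lapEigenspace μ
  have hU : IsCompact U := isCompact_setOf_dotProduct_self_eq_one.inter_right
    (Submodule.closed_of_finiteDimensional _)
  have hK : IsCompact (orbitEnergy Ψ '' U) := hU.image (continuous_orbitEnergy Ψ)
  have hconv : Convex ℝ (orbitEnergy Ψ '' U) := by
    rintro _ ⟨φ, ⟨(hφ1 : φ ⬝ᵥ φ = 1), hφ⟩, rfl⟩ _ ⟨ψ, ⟨(hψ1 : ψ ⬝ᵥ ψ = 1), hψ⟩, rfl⟩ a b ha hb hab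
    obtain ⟨φ', hφ', hφ'e⟩ := smul_orbitEnergy_mem_image (Ψ := Ψ) ha hφ
    obtain ⟨ψ', hψ', hψ'e⟩ := smul_orbitEnergy_mem_image (Ψ := Ψ) hb hψ
    obtain ⟨χ, hχ, hχe⟩ := exists_orbitEnergy_add hΨ hφ' hψ'
    rw [hφ'e, hψ'e] at hχe
    refine ⟨χ, ⟨?_, hχ⟩, hχe⟩
    have hs := sum_orbitEnergy_of_mem_lapEigenspace Ψ hχ
    simp only [hχe, Pi.add_apply, Pi.smul_apply, smul_eq_mul, Finset.sum_add_distrib,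
      ← Finset.mul_sum, sum_orbitEnergy_of_mem_lapEigenspace Ψ hφ,
      sum_orbitEnergy_of_mem_lapEigenspace Ψ hψ, hφ1, hψ1] at hs
    exact mul_left_cancel₀ hμ.ne' (by rw [← hs]; linear_combination μ * hab)
  -- The factor `μ / m` brings the size vector to coordinate sum `μ`.
  have hnot : (μ / m) • orbitSize Ψ ∉ orbitEnergy Ψ '' U := by
    rintro ⟨φ, ⟨-, hφ⟩, hφe⟩
    obtain ⟨χ, hχ, hχe⟩ := smul_orbitEnergy_mem_image (Ψ := Ψ) (c := m / μ) (by positivity) hφ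
    refine h ⟨χ, hχ, ?_⟩
    rw [hχe, hφe, smul_smul, div_mul_div_cancel₀ hμ.ne', div_self hm.ne', one_smul]
  obtain ⟨F, u, hu1, hu2⟩ := geometric_hahn_banach_point_closed hconv hK.isClosed hnot
  set z : G.EdgeOrbit Ψ → ℝ := fun O => F (Pi.single O 1)
  have hF (x : G.EdgeOrbit Ψ → ℝ) : F x = ∑ O, x O * z O := by
    conv_lhs => rw [pi_eq_sum_univ' x]
    simp only [z, map_sum, map_smul, smul_eq_mul]
  have hsize : F (orbitSize Ψ) = ∑ e : G.edgeSet, z (Quotient.mk (edgeOrbitSetoid Ψ) e) := by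
    rw [hF]
    have := sum_mul_edgeOrbit Ψ z (fun _ => 1)
    simpa [orbitSize] using this
  -- Subtracting the mean makes the total zero; on unit eigenvectors it subtracts exactly the value
  -- of `F` at the separated point.
  refine ⟨fun e => z (Quotient.mk (edgeOrbitSetoid Ψ) e) - F (orbitSize Ψ) / m, ?_,
    fun φ hφ hne => ?_⟩
  · rw [Finset.sum_sub_distrib, ← hsize, Finset.sum_const, Finset.card_univ, nsmul_eq_mul,
      mul_div_cancel₀ _ hm.ne', sub_self]
  · have hval (ψ : V → ℝ) (hψ : ψ ∈ G.lapEigenspace μ) :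
        ∑ e, (z (Quotient.mk (edgeOrbitSetoid Ψ) e) - F (orbitSize Ψ) / m) * edgeEnergy ψ e =
          F (orbitEnergy Ψ ψ) - F (orbitSize Ψ) / m * (μ * (ψ ⬝ᵥ ψ)) := by
      simp only [sub_mul, Finset.sum_sub_distrib, ← Finset.mul_sum,
        G.sum_edgeEnergy_of_mem_lapEigenspace hψ]
      rw [hF (orbitEnergy Ψ ψ), ← sum_mul_edgeOrbit Ψ z]
      rfl
    rw [hval φ hφ]
    obtain ⟨c, hc, hc1⟩ := exists_smul_dotProduct_self_eq_one hne
    have hlt := hu1.trans (hu2 _ ⟨_, ⟨hc1, Submodule.smul_mem _ c hφ⟩, rfl⟩)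
    rw [orbitEnergy_smul, map_smul, map_smul, smul_eq_mul, smul_eq_mul] at hlt
    rw [smul_dotProduct, dotProduct_smul, smul_eq_mul, smul_eq_mul] at hc1
    refine pos_of_mul_pos_right (a := c ^ 2) ?_ (sq_nonneg c)
    linear_combination hlt + (F (orbitSize Ψ) / m * μ) * hc1

/-- If every orbit has average energy one, averaging over `Ψ` turns the weighted energy into the
total weight. -/
theorem sum_sum_mul_edgeEnergy_comp {Ψ : Subgroup (G ≃g G)} [Fintype Ψ] {φ : V → ℝ}
    (hφ : orbitEnergy Ψ φ = orbitSize Ψ) (w : G.edgeSet → ℝ) :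
    ∑ σ : Ψ, ∑ e, w e * edgeEnergy (φ ∘ σ.1) e = Fintype.card Ψ * ∑ e, w e := by
  have havg (e : G.edgeSet) : ∑ σ : Ψ, edgeEnergy (φ ∘ σ.1) e = Fintype.card Ψ := by
    set O : G.EdgeOrbit Ψ := Quotient.mk (edgeOrbitSetoid Ψ) e
    -- The sum over `Ψ` is the same for every edge of the orbit, so it is determined by the orbit
    -- total.
    have hconst : ∀ f ∈ O.edges,
        ∑ σ : Ψ, edgeEnergy (φ ∘ σ.1) f = ∑ σ : Ψ, edgeEnergy (φ ∘ σ.1) e := by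
      intro f hf
      obtain ⟨τ, hτ, rfl⟩ := Quotient.exact (EdgeOrbit.mem_edges.mp hf).symm
      exact Fintype.sum_equiv (Equiv.mulRight (⟨τ, hτ⟩ : Ψ)) _ _
        fun σ => (edgeEnergy_comp τ (φ ∘ σ.1) e).symm
    have h1 := Finset.sum_congr rfl hconst
    have h2 : ∑ σ : Ψ, orbitEnergy Ψ (φ ∘ σ.1) O = Fintype.card Ψ * O.edges.card := by
      rw [Finset.sum_congr rfl fun σ _ => congrFun (orbitEnergy_comp σ.2 φ) O, hφ]
      simp [orbitSize]
    rw [Finset.sum_comm] at h1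
    rw [Finset.sum_const, nsmul_eq_mul] at h1
    have h3 := h2.symm.trans h1
    rw [mul_comm] at h3
    exact (mul_left_cancel₀ O.card_edges_pos.ne' h3).symm
  rw [Finset.sum_comm, Finset.mul_sum]
  refine Finset.sum_congr rfl fun e _ => ?_
  rw [← Finset.mul_sum, havg, mul_comm]

variable (G)

/-- Zero energy on a connected graph forces a constant, and a constant of sum zero vanishes. -/
theorem lambdaTwo_one_pos [Nontrivial V] (hG : G.Connected) : 0 < G.lambdaTwo (fun _ => 1) := by
  obtain ⟨φ, hne, hsum, hle⟩ := G.exists_rayleigh_le_lambdaTwo (fun _ => 1)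
  have hpos := dotProduct_self_pos hne
  have h0 := G.dotProduct_weightedLapMatrix_mulVec_nonneg (w := fun _ => 1)
    (fun _ => zero_le_one) φ
  by_contra! hle0
  have hz : φ ⬝ᵥ (G.weightedLapMatrix (fun _ => 1) *ᵥ φ) = 0 := by nlinarith
  rw [weightedLapMatrix_one, ← Matrix.toLinearMap₂'_apply',
    lapMatrix_toLinearMap₂'_apply'_eq_zero_iff_forall_reachable] at hz
  apply hne
  ext v
  have hc : ∑ u, φ u = Fintype.card V * φ v := by
    rw [Finset.sum_congr rfl fun u _ => hz u v (hG.preconnected u v)]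
    simp
  rw [hsum] at hc
  have : (Fintype.card V : ℝ) ≠ 0 := by simp
  simpa [this] using hc.symm

theorem lambdaTwo_le_lambdaMax [Nontrivial V] (w : G.edgeSet → ℝ) :
    G.lambdaTwo w ≤ G.lambdaMax w :=
  G.lapEigenvalue_monotone w (Fin.le_def.mpr (Nat.le_sub_one_of_lt Fintype.one_lt_card))

variable {G}

theorem nonempty_edgeSet [Nontrivial V] (hG : G.Connected) : Nonempty G.edgeSet := by
  obtain ⟨v⟩ := hG.nonempty
  obtain ⟨u, hu⟩ := hG.preconnected.exists_adj_of_nontrivial v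
  exact ⟨⟨s(v, u), hu⟩⟩

theorem dotProduct_weightedLapMatrix_one_add_mulVec (y : G.edgeSet → ℝ) (t : ℝ) (φ : V → ℝ) :
    φ ⬝ᵥ (G.weightedLapMatrix (fun e => 1 + t * y e) *ᵥ φ) =
      φ ⬝ᵥ (G.lapMatrix ℝ *ᵥ φ) + t * ∑ e, y e * edgeEnergy φ e := by
  rw [dotProduct_weightedLapMatrix_mulVec, ← sum_edgeEnergy_eq, Finset.mul_sum,
    ← Finset.sum_add_distrib]
  exact Finset.sum_congr rfl fun e _ => by ring

/-- Both signs of `t` are needed: the lower criterion moves along `y`, the upper one along `-y`. -/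
theorem exists_isNormalizedWeight_one_add {y : G.edgeSet → ℝ} (hy : ∑ e, y e = 0) :
    ∃ t₀ > 0, ∀ t, |t| ≤ t₀ → G.IsNormalizedWeight fun e => 1 + t * y e := by
  refine ⟨1 / (∑ e, |y e| + 1), by positivity, fun t ht => ⟨fun e => ?_, ?_⟩⟩
  · have hS : 0 ≤ ∑ e, |y e| := by positivity
    rw [le_div_iff₀ (by positivity)] at ht
    have h1 : |y e| ≤ ∑ e, |y e| :=
      Finset.single_le_sum (f := fun e => |y e|) (fun _ _ => abs_nonneg _) (Finset.mem_univ e)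
    have h2 : |t * y e| ≤ 1 := by
      rw [abs_mul]
      nlinarith [abs_nonneg t, abs_nonneg (y e)]
    linarith [neg_abs_le (t * y e)]
  · simp [Finset.sum_add_distrib, ← Finset.mul_sum, hy]

theorem sum_comp_iso (σ : G ≃g G) (φ : V → ℝ) : ∑ v, (φ ∘ σ) v = ∑ v, φ v :=
  Equiv.sum_comp σ.toEquiv φ

theorem dotProduct_comp_iso (σ : G ≃g G) (φ : V → ℝ) : (φ ∘ σ) ⬝ᵥ (φ ∘ σ) = φ ⬝ᵥ φ :=
  Equiv.sum_comp σ.toEquiv fun v => φ v * φ v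

variable [Nontrivial V] {Ψ : Subgroup (G ≃g G)}

theorem card_edgeSet_eq_of_orbitEnergy_eq {μ : ℝ} {φ : V → ℝ} (hφ : φ ∈ G.lapEigenspace μ)
    (h : orbitEnergy Ψ φ = orbitSize Ψ) : (Fintype.card G.edgeSet : ℝ) = μ * (φ ⬝ᵥ φ) := by
  rw [← sum_orbitEnergy_of_mem_lapEigenspace Ψ hφ, h, sum_orbitSize]

theorem ne_zero_of_orbitEnergy_eq (hG : G.Connected) {φ : V → ℝ}
    (h : orbitEnergy Ψ φ = orbitSize Ψ) : φ ≠ 0 := by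
  rintro rfl
  obtain ⟨e⟩ := nonempty_edgeSet hG
  have h1 := congrFun h (Quotient.mk (edgeOrbitSetoid Ψ) e)
  rw [← zero_smul ℝ (0 : V → ℝ), orbitEnergy_smul, zero_pow two_ne_zero, zero_smul] at h1
  have h2 := EdgeOrbit.card_edges_pos (Quotient.mk (edgeOrbitSetoid Ψ) e : G.EdgeOrbit Ψ)
  exact h2.ne h1

theorem isLowerConformallyRigid_iff (hG : G.Connected) (hΨ : IsVertexTransitive Ψ) :
    G.IsLowerConformallyRigid ↔
      ∃ φ ∈ G.lapEigenspace (G.lambdaTwo fun _ => 1), orbitEnergy Ψ φ = orbitSize Ψ := by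
  have := nonempty_edgeSet hG
  set μ := G.lambdaTwo fun _ => 1
  have hμ : 0 < μ := G.lambdaTwo_one_pos hG
  constructor
  · intro hrigid
    by_contra hno
    obtain ⟨y, hy, hpos⟩ := exists_pos_perturbation hΨ hμ hno
    -- `L - μ` is nonnegative only off the constants, so the argument lives on the sum-zero
    -- subspace.
    set W : Submodule ℝ (V → ℝ) := LinearMap.ker (∑ v, LinearMap.proj v : (V → ℝ) →ₗ[ℝ] ℝ)
    have hW (x : V → ℝ) : x ∈ W ↔ ∑ v, x v = 0 := by simp [W]
    have hray (x : V → ℝ) (hx : x ∈ W) : μ * (x ⬝ᵥ x) ≤ x ⬝ᵥ (G.lapMatrix ℝ *ᵥ x) := by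
      rw [← weightedLapMatrix_one]
      exact G.lambdaTwo_mul_le (fun _ => zero_le_one) ((hW x).mp hx)
    have hLW (x : V → ℝ) : G.lapMatrix ℝ *ᵥ x ∈ W := by
      rw [hW, ← weightedLapMatrix_one]
      exact G.sum_weightedLapMatrix_mulVec _ x
    set B := G.lapMatrix ℝ - μ • (1 : Matrix V V ℝ) with hB
    have hBx (x : V → ℝ) : B *ᵥ x = G.lapMatrix ℝ *ᵥ x - μ • x := by
      rw [hB, sub_mulVec, smul_mulVec, one_mulVec]
    have hBq (x : V → ℝ) : x ⬝ᵥ (B *ᵥ x) = x ⬝ᵥ (G.lapMatrix ℝ *ᵥ x) - μ * (x ⬝ᵥ x) := by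
      rw [hBx, dotProduct_sub, dotProduct_smul, smul_eq_mul]
    have hBT : Bᵀ = B := by
      rw [hB, transpose_sub, transpose_smul, transpose_one, (G.isSymm_lapMatrix (R := ℝ)).eq]
    obtain ⟨t₁, ht₁, hw⟩ := exists_isNormalizedWeight_one_add hy
    obtain ⟨t₂, ht₂, hp⟩ := exists_forall_pos_add_mul
      (K := {φ : V → ℝ | φ ⬝ᵥ φ = 1} ∩ W) (f := fun x => x ⬝ᵥ (B *ᵥ x))
      (g := fun x => ∑ e, y e * edgeEnergy x e)
      (isCompact_setOf_dotProduct_self_eq_one.inter_right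
        (Submodule.closed_of_finiteDimensional _))
      (by simp only [dotProduct, mulVec]; fun_prop)
      (continuous_finsetSum _ fun e _ => continuous_const.mul (continuous_edgeEnergy e))
      (fun x hx => by rw [hBq]; linarith [hray x hx.2])
      (fun x hx h => by
        -- A zero of the nonnegative form lies in its kernel, hence is an eigenvector for `μ`, where
        -- `y` is positive.
        refine hpos x ?_ ?_
        · rw [mem_lapEigenspace_iff, ← sub_eq_zero, ← hBx]
          refine mulVec_eq_zero_of_dotProduct_mulVec_eq_zero hBT W (fun x hx => ?_)
            (fun x hx => by rw [hBq]; linarith [hray x hx]) hx.2 h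
          rw [hBx]
          exact W.sub_mem (hLW x) (W.smul_mem μ hx)
        · rintro rfl
          simpa using hx.1)
    set t := min t₁ t₂
    have ht : 0 < t := lt_min ht₁ ht₂
    have hwt := hw t (by rw [abs_of_pos ht]; exact min_le_left _ _)
    -- On `W` the perturbed form exceeds `μ‖·‖²`, so this test vector forces `λ₂(1 + t y) > μ`.
    obtain ⟨φ, hne, hsum, hle⟩ := G.exists_rayleigh_le_lambdaTwo fun e => 1 + t * y e
    obtain ⟨c, hc, hc1⟩ := exists_smul_dotProduct_self_eq_one hne
    have h1 := hp t ht (min_le_right _ _) (c • φ) ⟨hc1, W.smul_mem c ((hW φ).mpr hsum)⟩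
    have h2 : (c • φ) ⬝ᵥ (G.weightedLapMatrix (fun e => 1 + t * y e) *ᵥ (c • φ)) ≤
        G.lambdaTwo (fun e => 1 + t * y e) * ((c • φ) ⬝ᵥ (c • φ)) := by
      simp only [mulVec_smul, smul_dotProduct, dotProduct_smul, smul_eq_mul]
      nlinarith [mul_le_mul_of_nonneg_left hle (mul_self_nonneg c)]
    rw [dotProduct_weightedLapMatrix_one_add_mulVec] at h2
    rw [hBq] at h1
    rw [hc1] at h1 h2
    have h3 := hrigid _ hwt
    change _ ≤ μ at h3
    linarith
  · rintro ⟨φ, hφ, he⟩ w ⟨hw0, hw⟩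
    have := Fintype.ofFinite Ψ
    have hcard := card_edgeSet_eq_of_orbitEnergy_eq hφ he
    have havg := sum_sum_mul_edgeEnergy_comp he w
    -- Each translate of `φ` has sum zero and the same norm, so the Rayleigh bound applies to it.
    have hle : ∑ _σ : Ψ, G.lambdaTwo w * (φ ⬝ᵥ φ) ≤
        ∑ σ : Ψ, ∑ e, w e * edgeEnergy (φ ∘ σ.1) e := by
      refine Finset.sum_le_sum fun σ _ => ?_
      rw [← dotProduct_weightedLapMatrix_mulVec, ← dotProduct_comp_iso σ.1]
      exact G.lambdaTwo_mul_le hw0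
        ((sum_comp_iso σ.1 φ).trans (G.sum_eq_zero_of_mem_lapEigenspace hμ hφ))
    rw [havg, hw, hcard, Finset.sum_const, Finset.card_univ, nsmul_eq_mul] at hle
    have hN : (0 : ℝ) < Fintype.card Ψ := Nat.cast_pos.mpr Fintype.card_pos
    exact le_of_mul_le_mul_right (le_of_mul_le_mul_left hle hN)
      (dotProduct_self_pos (ne_zero_of_orbitEnergy_eq hG he))

theorem isUpperConformallyRigid_iff (hG : G.Connected) (hΨ : IsVertexTransitive Ψ) :
    G.IsUpperConformallyRigid ↔
      ∃ φ ∈ G.lapEigenspace (G.lambdaMax fun _ => 1), orbitEnergy Ψ φ = orbitSize Ψ := by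
  have := nonempty_edgeSet hG
  set μ := G.lambdaMax fun _ => 1
  have hμ : 0 < μ := (G.lambdaTwo_one_pos hG).trans_le (G.lambdaTwo_le_lambdaMax _)
  constructor
  · intro hrigid
    by_contra hno
    obtain ⟨y, hy, hpos⟩ := exists_pos_perturbation hΨ hμ hno
    have hray (x : V → ℝ) : x ⬝ᵥ (G.lapMatrix ℝ *ᵥ x) ≤ μ * (x ⬝ᵥ x) := by
      rw [← weightedLapMatrix_one]
      exact G.dotProduct_weightedLapMatrix_mulVec_le _ x
    -- Mirror of the lower case: `μ - L` is nonnegative on the whole space, so no subspace is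
    -- needed.
    set B := μ • (1 : Matrix V V ℝ) - G.lapMatrix ℝ with hB
    have hBx (x : V → ℝ) : B *ᵥ x = μ • x - G.lapMatrix ℝ *ᵥ x := by
      rw [hB, sub_mulVec, smul_mulVec, one_mulVec]
    have hBq (x : V → ℝ) : x ⬝ᵥ (B *ᵥ x) = μ * (x ⬝ᵥ x) - x ⬝ᵥ (G.lapMatrix ℝ *ᵥ x) := by
      rw [hBx, dotProduct_sub, dotProduct_smul, smul_eq_mul]
    have hBT : Bᵀ = B := by
      rw [hB, transpose_sub, transpose_smul, transpose_one, (G.isSymm_lapMatrix (R := ℝ)).eq]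
    obtain ⟨t₁, ht₁, hw⟩ := exists_isNormalizedWeight_one_add hy
    obtain ⟨t₂, ht₂, hp⟩ := exists_forall_pos_add_mul
      (K := {φ : V → ℝ | φ ⬝ᵥ φ = 1}) (f := fun x => x ⬝ᵥ (B *ᵥ x))
      (g := fun x => ∑ e, y e * edgeEnergy x e)
      isCompact_setOf_dotProduct_self_eq_one
      (by simp only [dotProduct, mulVec]; fun_prop)
      (continuous_finsetSum _ fun e _ => continuous_const.mul (continuous_edgeEnergy e))
      (fun x hx => by rw [hBq]; linarith [hray x])
      (fun x hx h => by
        refine hpos x ?_ ?_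
        · rw [mem_lapEigenspace_iff, eq_comm, ← sub_eq_zero, ← hBx]
          exact mulVec_eq_zero_of_dotProduct_mulVec_eq_zero hBT ⊤ (fun _ _ => trivial)
            (fun x _ => by rw [hBq]; linarith [hray x]) trivial h
        · rintro rfl
          simp at hx)
    set t := min t₁ t₂
    have ht : 0 < t := lt_min ht₁ ht₂
    have hwt := hw (-t) (by rw [abs_neg, abs_of_pos ht]; exact min_le_left _ _)
    obtain ⟨φ, hne, heq⟩ := G.exists_rayleigh_eq_lambdaMax fun e => 1 + -t * y e
    obtain ⟨c, hc, hc1⟩ := exists_smul_dotProduct_self_eq_one hne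
    have h1 := hp t ht (min_le_right _ _) (c • φ) hc1
    have h2 : (c • φ) ⬝ᵥ (G.weightedLapMatrix (fun e => 1 + -t * y e) *ᵥ (c • φ)) =
        G.lambdaMax (fun e => 1 + -t * y e) * ((c • φ) ⬝ᵥ (c • φ)) := by
      simp only [mulVec_smul, smul_dotProduct, dotProduct_smul, smul_eq_mul, heq]
      ring
    rw [dotProduct_weightedLapMatrix_one_add_mulVec] at h2
    rw [hBq] at h1
    rw [hc1] at h1 h2
    have h3 := hrigid _ hwt
    change μ ≤ _ at h3
    linarith
  · rintro ⟨φ, hφ, he⟩ w ⟨hw0, hw⟩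
    have := Fintype.ofFinite Ψ
    have hcard := card_edgeSet_eq_of_orbitEnergy_eq hφ he
    have havg := sum_sum_mul_edgeEnergy_comp he w
    have hle : ∑ σ : Ψ, ∑ e, w e * edgeEnergy (φ ∘ σ.1) e ≤
        ∑ _σ : Ψ, G.lambdaMax w * (φ ⬝ᵥ φ) := by
      refine Finset.sum_le_sum fun σ _ => ?_
      rw [← dotProduct_weightedLapMatrix_mulVec, ← dotProduct_comp_iso σ.1]
      exact G.dotProduct_weightedLapMatrix_mulVec_le w _
    rw [havg, hw, hcard, Finset.sum_const, Finset.card_univ, nsmul_eq_mul] at hle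
    have hN : (0 : ℝ) < Fintype.card Ψ := Nat.cast_pos.mpr Fintype.card_pos
    exact le_of_mul_le_mul_right (le_of_mul_le_mul_left hle hN)
      (dotProduct_self_pos (ne_zero_of_orbitEnergy_eq hG he))

/-- Nonvanishing is automatic: some edge exists, and its orbit has positive size. -/
theorem exists_hasEigenvector_orbitEnergy_eq_iff (hG : G.Connected) (μ : ℝ) :
    (∃ φ ∈ G.lapEigenspace μ, orbitEnergy Ψ φ = orbitSize Ψ) ↔
      ∃ φ : V → ℝ, G.lapOperator.HasEigenvector μ φ ∧ orbitEnergy Ψ φ = orbitSize Ψ :=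
  ⟨fun ⟨φ, hφ, h⟩ => ⟨φ, ⟨hφ, ne_zero_of_orbitEnergy_eq hG h⟩, h⟩,
    fun ⟨φ, hφ, h⟩ => ⟨φ, hφ.1, h⟩⟩

theorem edgeSqLength_fin_one (p : V → EuclideanSpace ℝ (Fin 1)) (e : G.edgeSet) :
    edgeSqLength p e = edgeEnergy (fun v => p v 0) e := by
  rcases e with ⟨⟨u, v⟩, h⟩
  change ‖p u - p v‖ ^ 2 = (p u 0 - p v 0) ^ 2
  simp [EuclideanSpace.norm_sq_eq]

theorem exists_isOrbitIsometric_iff (μ : ℝ) :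
    (∃ φ ∈ G.lapEigenspace μ, orbitEnergy Ψ φ = orbitSize Ψ) ↔
      ∃ p : V → EuclideanSpace ℝ (Fin 1), G.IsSpectralEmbedding μ p ∧ IsOrbitIsometric Ψ p := by
  constructor
  · rintro ⟨φ, hφ, h⟩
    refine ⟨fun v => WithLp.toLp 2 fun _ => φ v, fun _ => hφ, 1, one_pos, fun O => ?_⟩
    simp only [edgeSqLength_fin_one]
    change 1 / (O.edges.card : ℝ) * orbitEnergy Ψ φ O = 1
    rw [h]
    exact one_div_mul_cancel O.card_edges_pos.ne'
  · rintro ⟨p, hp, c, hc, h⟩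
    -- The only coordinate of `p` has energy `c |O|` on each orbit; scaling energies by `c⁻¹` leaves
    -- `|O|`.
    obtain ⟨χ, hχ, hχe⟩ := smul_orbitEnergy_mem_image (Ψ := Ψ) (inv_nonneg.mpr hc.le) (hp 0)
    refine ⟨χ, hχ, ?_⟩
    ext O
    have hO := h O
    simp only [edgeSqLength_fin_one] at hO
    change 1 / (O.edges.card : ℝ) * orbitEnergy Ψ (fun v => p v 0) O = c at hO
    rw [hχe, Pi.smul_apply, smul_eq_mul, orbitSize, ← hO]
    have := O.card_edges_pos.ne'
    rw [← hO] at hc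
    have h2 := (pos_of_mul_pos_right hc (by positivity)).ne'
    field_simp

end Rigidity

end SimpleGraph

end

theorem theorem5 {V : Type*} [Fintype V] [DecidableEq V] [Nontrivial V]
    (G : SimpleGraph V) [DecidableRel G.Adj] (hG : G.Connected)
    (Ψ : Subgroup (G ≃g G)) (hΨ : SimpleGraph.IsVertexTransitive Ψ) :
    -- the orbit-energy image of each eigenspace is a convex cone
    (∀ μ : ℝ, 0 < μ → G.lapOperator.HasEigenvalue μ →
      ∃ C : PointedCone ℝ (G.EdgeOrbit Ψ → ℝ),
        (C : Set (G.EdgeOrbit Ψ → ℝ)) =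
          SimpleGraph.orbitEnergy Ψ '' (G.lapEigenspace μ : Set (V → ℝ))) ∧
    -- lower conformal rigidity is certified by a single eigenvector
    (G.IsLowerConformallyRigid ↔
      ∃ φ : V → ℝ, G.lapOperator.HasEigenvector (G.lambdaTwo fun _ => 1) φ ∧
        SimpleGraph.orbitEnergy Ψ φ = SimpleGraph.orbitSize Ψ) ∧
    (G.IsLowerConformallyRigid ↔
      ∃ p : V → EuclideanSpace ℝ (Fin 1),
        G.IsSpectralEmbedding (G.lambdaTwo fun _ => 1) p ∧
        SimpleGraph.IsOrbitIsometric Ψ p) ∧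
    -- upper conformal rigidity is certified by a single eigenvector
    (G.IsUpperConformallyRigid ↔
      ∃ φ : V → ℝ, G.lapOperator.HasEigenvector (G.lambdaMax fun _ => 1) φ ∧
        SimpleGraph.orbitEnergy Ψ φ = SimpleGraph.orbitSize Ψ) ∧
    (G.IsUpperConformallyRigid ↔
      ∃ p : V → EuclideanSpace ℝ (Fin 1),
        G.IsSpectralEmbedding (G.lambdaMax fun _ => 1) p ∧
        SimpleGraph.IsOrbitIsometric Ψ p) := by
  refine ⟨fun μ _ _ => SimpleGraph.exists_pointedCone_eq_image_orbitEnergy hΨ μ, ?_, ?_, ?_, ?_⟩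
  · rw [SimpleGraph.isLowerConformallyRigid_iff hG hΨ,
      SimpleGraph.exists_hasEigenvector_orbitEnergy_eq_iff hG]
  · rw [SimpleGraph.isLowerConformallyRigid_iff hG hΨ, SimpleGraph.exists_isOrbitIsometric_iff]
  · rw [SimpleGraph.isUpperConformallyRigid_iff hG hΨ,
      SimpleGraph.exists_hasEigenvector_orbitEnergy_eq_iff hG]
  · rw [SimpleGraph.isUpperConformallyRigid_iff hG hΨ, SimpleGraph.exists_isOrbitIsometric_iff]
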